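/- Conventions. A variety of groups is the class of all groups satisfying a given set of laws. $\mathcal{A}$ is the variety of abelian groups and, for $s\ge 1$, $\mathcal{A}_s$ is the variety of abelian groups satisfying $x^s=1$. For varieties $\mathcal{M},\mathcal{N}$, the product $\mathcal{M}\mathcal{N}$ is the class of groups $H$ having a normal subgroup $K\in\mathcal{M}$ with $H/K\in\mathcal{N}$. A group is $k$-generated if it is generated by $k$ (not necessarily distinct) elements. Let $\mathcal{M}$ be an arbitrary variety of groups. (1) Let $G\in\mathcal{M}$ be an $m$-generated group of finite exponent $e\ge 1$. Then $G$ embeds in a $4$-generated group $H\in\mathcal{M}\mathcal{A}_s$, where $s=e^{m+1}$; this $H$ has exponent dividing $e^{m+2}$. (2) Every finite group $G\in\mathcal{M}$ embeds in a $4$-generated finite group $H\in\mathcal{M}\mathcal{A}$. In particular, every finite solvable group of derived length $l$ embeds in a $4$-generated finite solvable group of derived length $l+1$, and, for every prime $p$, every finite $p$-group of derived length $l$ embeds in a $4$-generated finite $p$-group of derived length $l+1$. -/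

import Mathlib

universe u

/-- A variety of groups, presented by a set of laws `w = 1`, where `w` is a word in countably many
variables. -/
structure GroupVariety where
  /-- the words that are required to be identically trivial -/
  laws : Set (FreeGroup ℕ)

namespace GroupVariety

/-- The group `G` belongs to the variety `M`: every law of `M` holds in `G` under every
substitution of elements of `G` for the variables. -/
def Mem (M : GroupVariety) (G : Type*) [Group G] : Prop :=
  ∀ w ∈ M.laws, ∀ v : ℕ → G, FreeGroup.lift v w = 1

/-- The variety `𝒜` of all abelian groups, with the law `[x, y] = 1`. -/
def abelian : GroupVariety where
  laws := {(FreeGroup.of 0)⁻¹ * (FreeGroup.of 1)⁻¹ * FreeGroup.of 0 * FreeGroup.of 1}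

/-- The variety `𝒜ₛ` of abelian groups of exponent dividing `s`, with the laws `[x, y] = 1` and
`x ^ s = 1`. -/
def abelianOfExponent (s : ℕ) : GroupVariety where
  laws := {(FreeGroup.of 0)⁻¹ * (FreeGroup.of 1)⁻¹ * FreeGroup.of 0 * FreeGroup.of 1,
    FreeGroup.of 0 ^ s}

/-- The group `G` belongs to the product `M N` of the varieties `M` and `N`: it is an extension of
a normal subgroup in `M` by a quotient group in `N`. -/
def MemProd (M N : GroupVariety) (G : Type*) [Group G] : Prop :=
  ∃ (K : Subgroup G) (_ : K.Normal), M.Mem K ∧ N.Mem (G ⧸ K)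

end GroupVariety

/-- The group `G` is generated by some `m` (not necessarily distinct) elements. -/
def IsGeneratedByCard (m : ℕ) (G : Type*) [Group G] : Prop :=
  ∃ g : Fin m → G, Subgroup.closure (Set.range g) = ⊤

/-- `G` embeds in `H` as a subgroup. -/
def GroupEmbedsIn (G H : Type*) [Group G] [Group H] : Prop :=
  ∃ φ : G →* H, Function.Injective φ

/-- `G` is solvable and its derived length is exactly `l`. -/
def HasDerivedLength (G : Type*) [Group G] (l : ℕ) : Prop :=
  IsLeast {n : ℕ | derivedSeries G n = ⊥} l

/-!
Let `G` be generated by `g₀, …, g_{m-1}` and have exponent `e`, and put `s = e ^ (m + 1)`. The group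
`H` is generated by four elements of the wreath product of `G` with `A = (ℤ/s)³`: the
generators `a, b, c` of `A`, and one function `f : A → G` in the base group. Write `⌊x / e ^ k⌋` for
the quotient of the representative of `x ∈ ℤ/s` in `[0, s)`; modulo `e` it is the `k`-th digit of `x`.
The function `f` is

  `f (x, y, z) = g_z ^ (⌊x / e ^ z⌋ * ⌊y / e ^ (m - z)⌋)` for `z < m`, and `1` on all other layers `z`.

Each layer takes values in a cyclic group, so difference operators act on the exponents there as
they do in a commutative setting. Translating `x` by `e ^ i` changes digits `k ≥ i` only, and adds
one to the `i`-th digit; so differencing `f` along `a ^ (e ^ i)` gives `1` on the layers `z < i`,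
and differencing along `b ^ (e ^ (m - i))` gives `1` on the layers `z > i`. Differencing in both
directions leaves the constant `g_i` on the layer `z = i` and `1` elsewhere
(`second_difference_digitFunction`). After a translation by `c ^ i` the support is the layer `z = 0`
for every `i`, hence the functions that are constant on the layer `z = 0` and trivial elsewhere form
a copy of `G` inside `H`.

Since `H` meets the base group `G ^ A` in a subgroup with quotient in `𝒜ₛ`, it is in `M 𝒜ₛ` and has
exponent dividing `e * s`. As differences are commutators, the copy of `G` lies in the commutator
subgroup of `H`; this makes the derived length of `H` exceed that of `G`, while the abelian quotient
bounds it by one more than that of `G`.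
-/

open RegularWreathProduct
open scoped commutatorElement

/-! ### Varieties and separating families of homomorphisms -/

namespace GroupVariety

/-- A variety is closed under subgroups of Cartesian powers. -/
theorem Mem.of_separating {M : GroupVariety} {G K ι : Type*} [Group G] [Group K] (hG : M.Mem G)
    (ψ : ι → K →* G) (hψ : ∀ k, (∀ i, ψ i k = 1) → k = 1) : M.Mem K := by
  intro w hw v
  refine hψ _ fun i => ?_
  have h : (ψ i).comp (FreeGroup.lift v) = FreeGroup.lift (fun n => ψ i (v n)) := by
    ext n
    simp
  rw [← MonoidHom.comp_apply, h]
  exact hG w hw _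

theorem abelianOfExponent_mem {A : Type*} [CommGroup A] {s : ℕ} (h : ∀ a : A, a ^ s = 1) :
    (abelianOfExponent s).Mem A := by
  intro w hw v
  rcases hw with rfl | rfl
  · simp [mul_comm]
  · simp [h]

theorem abelian_mem {A : Type*} [CommGroup A] : abelian.Mem A := by
  intro w hw v
  obtain rfl := hw
  simp [mul_comm]

end GroupVariety

/-! ### Derived series under an embedding into the commutator subgroup -/

theorem map_derivedSeries_le_derivedSeries_succ {G H : Type*} [Group G] [Group H] (φ : G →* H)
    (hφ : φ.range ≤ commutator H) (n : ℕ) :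
    (derivedSeries G n).map φ ≤ derivedSeries H (n + 1) := by
  induction n with
  | zero => simpa [← MonoidHom.range_eq_map] using hφ
  | succ n ih =>
    rw [derivedSeries_succ, derivedSeries_succ, Subgroup.map_commutator]
    exact Subgroup.commutator_mono ih ih

theorem derivedSeries_succ_le_map_subtype {H : Type*} [Group H] (K : Subgroup H)
    (hK : commutator H ≤ K) (n : ℕ) :
    derivedSeries H (n + 1) ≤ (derivedSeries K n).map K.subtype := by
  induction n with
  | zero => simpa [← MonoidHom.range_eq_map] using hK
  | succ n ih =>
    rw [derivedSeries_succ H, derivedSeries_succ K, Subgroup.map_commutator]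
    exact Subgroup.commutator_mono ih ih

theorem derivedSeries_eq_bot_of_separating {G K ι : Type*} [Group G] [Group K] {n : ℕ}
    (hG : derivedSeries G n = ⊥) (ψ : ι → K →* G) (hψ : ∀ k, (∀ i, ψ i k = 1) → k = 1) :
    derivedSeries K n = ⊥ := by
  refine (Subgroup.eq_bot_iff_forall _).2 fun k hk => hψ k fun i => ?_
  have h := map_derivedSeries_le_derivedSeries (ψ i) n (Subgroup.mem_map_of_mem _ hk)
  rwa [hG, Subgroup.mem_bot] at h

/-! ### Subgroups of a wreath product with abelian top group -/

namespace RegularWreathProduct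

variable {G A : Type*} [Group G]

/-- The element of the base group of the wreath product given by the function `F`. -/
def base [Group A] : (A → G) →* G ≀ᵣ A where
  toFun F := ⟨F, 1⟩
  map_one' := rfl
  map_mul' F F' := by ext <;> simp

theorem base_injective [Group A] : Function.Injective (base : (A → G) →* G ≀ᵣ A) :=
  fun _ _ h => congrArg RegularWreathProduct.left h

theorem conj_base [CommGroup A] (F : A → G) (a : A) :
    inl a⁻¹ * base F * inl a = base fun q => F (a * q) := by
  ext <;> simp [base]

theorem commutator_base [CommGroup A] (F : A → G) (a : A) :
    ⁅(base F)⁻¹, inl a⁻¹⁆ = base fun q => (F q)⁻¹ * F (a * q) := by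
  have h : ⁅(base F)⁻¹, inl a⁻¹⁆ = (base F)⁻¹ * (inl a⁻¹ * base F * inl a : G ≀ᵣ A) := by
    simp [commutatorElement_def, mul_assoc]
  rw [h, conj_base, ← map_inv, ← map_mul]
  rfl

/-- A second difference of a function in `H` lies in the commutator subgroup of `H`. -/
theorem second_difference_mem_commutator [CommGroup A] {H : Subgroup (G ≀ᵣ A)} {F : A → G}
    (hF : base F ∈ H) {a b : A} (ha : inl a ∈ H) (hb : inl b ∈ H) :
    base (fun q => ((F q)⁻¹ * F (a * q))⁻¹ * ((F (b * q))⁻¹ * F (a * (b * q)))) ∈ ⁅H, H⁆ := by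
  have inv_inl : ∀ {x : A}, inl x ∈ H → (inl x⁻¹ : G ≀ᵣ A) ∈ H := fun {x} hx => by
    rw [map_inv]
    exact H.inv_mem hx
  have h := Subgroup.commutator_mem_commutator (H.inv_mem hF) (inv_inl ha)
  rw [commutator_base] at h
  have h' := Subgroup.commutator_mem_commutator
    (H.inv_mem (Subgroup.commutator_le_self H h)) (inv_inl hb)
  rwa [commutator_base] at h'

section Subgroups

variable [CommGroup A] (H : Subgroup (G ≀ᵣ A))

/-- The projection of a subgroup of the wreath product to the top group. -/
def topHom : H →* A := rightHom.comp H.subtype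

theorem right_eq_one_of_mem_ker {H : Subgroup (G ≀ᵣ A)} (k : (topHom H).ker) :
    (k : H).1.right = 1 := k.2

/-- Evaluation at `q` on the intersection of a subgroup of the wreath product with the base
group. -/
def evalHom (q : A) : (topHom H).ker →* G where
  toFun k := (k : H).1.left q
  map_one' := rfl
  map_mul' k k' := by simp [right_eq_one_of_mem_ker k]

theorem evalHom_separating (k : (topHom H).ker) (hk : ∀ q, evalHom H q k = 1) : k = 1 :=
  Subtype.ext <| Subtype.ext <| RegularWreathProduct.ext (funext hk) (right_eq_one_of_mem_ker k)

theorem memProd_subgroup {M N : GroupVariety} (hG : M.Mem G) (hA : N.Mem A) : M.MemProd N H :=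
  ⟨(topHom H).ker, inferInstance, hG.of_separating _ (evalHom_separating H),
    hA.of_separating (fun _ : Unit => QuotientGroup.kerLift (topHom H)) fun _ h =>
      QuotientGroup.kerLift_injective (topHom H) ((h ()).trans (map_one _).symm)⟩

theorem pow_eq_one_of_subgroup {e s : ℕ} (hG : ∀ g : G, g ^ e = 1) (hA : ∀ a : A, a ^ s = 1)
    (h : H) : h ^ (s * e) = 1 := by
  have hk : h ^ s ∈ (topHom H).ker := by rw [MonoidHom.mem_ker, map_pow, hA]
  have h1 : (⟨h ^ s, hk⟩ : (topHom H).ker) ^ e = 1 :=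
    evalHom_separating H _ fun q => by rw [map_pow, hG]
  rw [pow_mul]
  exact congrArg Subtype.val h1

theorem derivedSeries_subgroup_eq_bot {n : ℕ} (hG : derivedSeries G n = ⊥) :
    derivedSeries H (n + 1) = ⊥ := by
  have h := derivedSeries_succ_le_map_subtype _ (Abelianization.commutator_subset_ker (topHom H)) n
  rwa [derivedSeries_eq_bot_of_separating hG _ (evalHom_separating H), Subgroup.map_bot,
    le_bot_iff] at h

end Subgroups

end RegularWreathProduct

/-! ### The digit function and its second differences -/

theorem div_pow_mod_eq {e m k : ℕ} (hk : k ≤ m) (n : ℕ) :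
    n % e ^ (m + 1) / e ^ k % e = n / e ^ k % e := by
  rw [← Nat.mod_mul_right_div_self, ← Nat.mod_mul_right_div_self, ← pow_succ,
    Nat.mod_mod_of_dvd _ (pow_dvd_pow e (by omega))]

/-- Adding `e ^ i` to `x` does not change the digits below the `i`-th, modulo `e`, and increases the
`i`-th one by `1`. -/
theorem dvd_digit_add_pow_sub {e m i k : ℕ} (he : 0 < e) (hk : k ≤ m) (hki : k ≤ i)
    (x : ZMod (e ^ (m + 1))) :
    (e : ℤ) ∣ ((x + (e ^ i : ℕ)).val / e ^ k : ℕ) - (x.val / e ^ k : ℕ)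
      - (if k = i then 1 else 0) := by
  have : NeZero (e ^ (m + 1)) := ⟨(pow_pos he _).ne'⟩
  have h1 : (x + (e ^ i : ℕ)).val = (x.val + e ^ i) % e ^ (m + 1) := by
    rw [ZMod.val_add, ZMod.val_natCast, Nat.add_mod_mod]
  have h2 : (x.val + e ^ i) / e ^ k = x.val / e ^ k + e ^ (i - k) := by
    rw [show e ^ i = e ^ k * e ^ (i - k) by rw [← pow_add]; congr 1; omega,
      Nat.add_mul_div_left _ _ (pow_pos he k)]
  have h3 : x.val / e ^ k + e ^ (i - k) ≡ (x + (e ^ i : ℕ)).val / e ^ k [MOD e] := by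
    rw [← h2, h1]
    exact (div_pow_mod_eq hk _).symm
  have h4 : (e : ℤ) ∣ ((e ^ (i - k) : ℕ) : ℤ) - (if k = i then 1 else 0) := by
    split_ifs with h
    · simp [h]
    · rw [sub_zero]
      exact_mod_cast dvd_pow_self e (by omega)
  have h5 := dvd_add h3.dvd h4
  refine h5.trans (dvd_of_eq ?_)
  rw [Nat.cast_add]
  ring

/-- The function `(x, y, z) ↦ g_z ^ (⌊x / e ^ z⌋ * ⌊y / e ^ (m - z)⌋)` on `(ℤ/s)³`,
`s = e ^ (m + 1)`, where residues stand for their representatives in `[0, s)`. It is meant for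
sequences `g` with `g_z = 1` for `z ≥ m`, for which the truncation of `m - z` is harmless. -/
def digitFunction {G : Type*} [Group G] (e m s : ℕ) (g : ℕ → G)
    (q : Multiplicative (ZMod s × ZMod s × ZMod s)) : G :=
  g q.toAdd.2.2.val ^
    (q.toAdd.1.val / e ^ q.toAdd.2.2.val * (q.toAdd.2.1.val / e ^ (m - q.toAdd.2.2.val)))

/-- The function with value `g` on the layer `z = 0` and `1` elsewhere. -/
def layerHom (G : Type*) [Group G] (s : ℕ) :
    G →* (Multiplicative (ZMod s × ZMod s × ZMod s) → G) where
  toFun g q := if q.toAdd.2.2 = 0 then g else 1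
  map_one' := by ext; simp
  map_mul' g g' := by ext q; by_cases h : q.toAdd.2.2 = 0 <;> simp [h]

theorem layerHom_injective (G : Type*) [Group G] (s : ℕ) : Function.Injective (layerHom G s) :=
  fun g g' h => by simpa [layerHom] using congrFun h 1

theorem second_difference_pow {G : Type*} [Group G] (g : G) (X X' Y Y' : ℕ) :
    ((g ^ (X * Y))⁻¹ * g ^ (X' * Y))⁻¹ * ((g ^ (X * Y'))⁻¹ * g ^ (X' * Y')) =
      g ^ (((X' : ℤ) - X) * ((Y' : ℤ) - Y)) := by
  simp only [← zpow_natCast, ← zpow_neg, ← zpow_add]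
  congr 1
  push_cast
  ring

/-- The second difference of the digit function, translated by `i` in the third coordinate. -/
theorem second_difference_digitFunction {G : Type*} [Group G] {e m i : ℕ} (he : 0 < e)
    (hG : ∀ x : G, x ^ e = 1) {g : ℕ → G} (hg : ∀ n, m ≤ n → g n = 1) (hi : i < m) :
    let s := e ^ (m + 1)
    let F : Multiplicative (ZMod s × ZMod s × ZMod s) → G := fun q =>
      digitFunction e m s g (Multiplicative.ofAdd (0, 0, (i : ZMod s)) * q)
    let a := Multiplicative.ofAdd (((e ^ i : ℕ) : ZMod s), (0 : ZMod s), (0 : ZMod s))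
    let b := Multiplicative.ofAdd ((0 : ZMod s), ((e ^ (m - i) : ℕ) : ZMod s), (0 : ZMod s))
    (fun q => ((F q)⁻¹ * F (a * q))⁻¹ * ((F (b * q))⁻¹ * F (a * (b * q)))) =
      layerHom G s (g i) := by
  intro s F a b
  rcases Nat.eq_or_lt_of_le (Nat.succ_le_of_lt he) with rfl | he1
  · -- For `e = 1` all layers coincide, but then `G` is trivial.
    have : ∀ x : G, x = 1 := fun x => by simpa using hG x
    funext q
    rw [this (layerHom G s (g i) q)]
    exact this _
  have : NeZero s := ⟨(pow_pos he _).ne'⟩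
  have his : i < s := hi.trans ((Nat.lt_succ_self m).trans (Nat.lt_pow_self he1))
  funext ⟨x, y, z⟩
  obtain ⟨k, hk⟩ : ∃ k, k = ((i : ZMod s) + z).val := ⟨_, rfl⟩
  have hkz : k = i ↔ z = 0 := by
    constructor
    · rintro rfl
      have := (ZMod.natCast_zmod_val ((k : ZMod s) + z)).symm
      rw [← hk] at this
      simpa using this
    · rintro rfl
      rw [hk, add_zero, ZMod.val_natCast_of_lt his]
  set X := x.val / e ^ k
  set X' := (x + (e ^ i : ℕ)).val / e ^ k with hX'
  set Y := y.val / e ^ (m - k)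
  set Y' := (y + (e ^ (m - i) : ℕ)).val / e ^ (m - k) with hY'
  have hlhs : ∀ x y, F (Multiplicative.ofAdd (x, y, z)) =
      g k ^ (x.val / e ^ k * (y.val / e ^ (m - k))) := by
    intro x y
    simp only [F, digitFunction, toAdd_mul, toAdd_ofAdd, Prod.snd_add, Prod.fst_add, zero_add, hk]
  have hab : a * Multiplicative.ofAdd (x, y, z) = Multiplicative.ofAdd (x + (e ^ i : ℕ), y, z) := by
    simp [a, ← ofAdd_add, add_comm]
  have hb : b * Multiplicative.ofAdd (x, y, z) =
      Multiplicative.ofAdd (x, y + (e ^ (m - i) : ℕ), z) := by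
    simp [b, ← ofAdd_add, add_comm]
  have habb : a * Multiplicative.ofAdd (x, y + ((e ^ (m - i) : ℕ) : ZMod s), z) =
      Multiplicative.ofAdd (x + (e ^ i : ℕ), y + (e ^ (m - i) : ℕ), z) := by
    simp [a, ← ofAdd_add, add_comm]
  change ((F (Multiplicative.ofAdd (x, y, z)))⁻¹ * F (a * Multiplicative.ofAdd (x, y, z)))⁻¹ *
    ((F (b * Multiplicative.ofAdd (x, y, z)))⁻¹ * F (a * (b * Multiplicative.ofAdd (x, y, z)))) =
    if z = 0 then g i else 1
  rw [hb, hab, habb, hlhs, hlhs, hlhs, hlhs, second_difference_pow, ← hX', ← hY']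
  have hone : ∀ {n : ℤ}, (e : ℤ) ∣ n → g k ^ n = 1 := by
    rintro _ ⟨t, rfl⟩
    rw [zpow_mul, zpow_natCast, hG, one_zpow]
  rcases le_or_gt m k with hmk | hkm
  · rw [if_neg fun h => by have := hkz.2 h; omega, hg k hmk, one_zpow]
  rcases lt_trichotomy k i with hlt | heq | hgt
  · have h := dvd_digit_add_pow_sub he hkm.le hlt.le x
    rw [if_neg hlt.ne, sub_zero] at h
    rw [if_neg fun h => by have := hkz.2 h; omega]
    exact hone (h.mul_right _)
  · have h1 := dvd_digit_add_pow_sub he hkm.le heq.le x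
    have h2 := dvd_digit_add_pow_sub he (Nat.sub_le m k) (by omega : m - k ≤ m - i) y
    rw [if_pos heq] at h1
    rw [if_pos (by omega)] at h2
    change (e : ℤ) ∣ (X' : ℤ) - X - 1 at h1
    change (e : ℤ) ∣ (Y' : ℤ) - Y - 1 at h2
    have h3 : (e : ℤ) ∣ ((X' : ℤ) - X) * ((Y' : ℤ) - Y) - 1 := by
      have h := dvd_add (h1.mul_right ((Y' : ℤ) - Y)) h2
      refine h.trans (dvd_of_eq ?_)
      ring
    have h4 := hone h3
    rw [zpow_sub, zpow_one, mul_inv_eq_one] at h4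
    rw [if_pos (hkz.1 heq), h4, heq]
  · have h := dvd_digit_add_pow_sub he (Nat.sub_le m k) (by omega : m - k ≤ m - i) y
    rw [if_neg (by omega), sub_zero] at h
    rw [if_neg fun h => by have := hkz.2 h; omega]
    exact hone (h.mul_left _)

/-! ### The four-generated group -/

/-- A group `G` of exponent dividing `e` with `m` generators embeds into the commutator subgroup of a
four-generated subgroup of the wreath product of `G` with `(ℤ/s)³`, `s = e ^ (m + 1)`. -/
theorem exists_fourGenerated_subgroup {G : Type*} [Group G] {m e : ℕ} (he : 0 < e)
    (hG : ∀ x : G, x ^ e = 1) (hm : IsGeneratedByCard m G) :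
    ∃ (H : Subgroup (G ≀ᵣ Multiplicative
        (ZMod (e ^ (m + 1)) × ZMod (e ^ (m + 1)) × ZMod (e ^ (m + 1))))) (φ : G →* H),
      IsGeneratedByCard 4 H ∧ Function.Injective φ ∧ φ.range ≤ commutator H := by
  obtain ⟨g₀, hg₀⟩ := hm
  set s := e ^ (m + 1)
  let g : ℕ → G := fun n => if h : n < m then g₀ ⟨n, h⟩ else 1
  have hg : ∀ n, m ≤ n → g n = 1 := fun n hn => dif_neg (by omega)
  let a : Multiplicative (ZMod s × ZMod s × ZMod s) := Multiplicative.ofAdd (1, 0, 0)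
  let b : Multiplicative (ZMod s × ZMod s × ZMod s) := Multiplicative.ofAdd (0, 1, 0)
  let c : Multiplicative (ZMod s × ZMod s × ZMod s) := Multiplicative.ofAdd (0, 0, 1)
  let w : Fin 4 → G ≀ᵣ Multiplicative (ZMod s × ZMod s × ZMod s) :=
    ![inl a, inl b, inl c, base (digitFunction e m s g)]
  let H := Subgroup.closure (Set.range w)
  have hw : ∀ j, w j ∈ H := fun j => Subgroup.subset_closure ⟨j, rfl⟩
  have ha : ∀ n : ℕ, inl (Multiplicative.ofAdd ((n : ZMod s), (0 : ZMod s), (0 : ZMod s))) ∈ H := by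
    intro n
    have h := H.pow_mem (hw 0) n
    rw [show w 0 = inl a from rfl, ← map_pow] at h
    simpa [a, ← ofAdd_nsmul] using h
  have hb : ∀ n : ℕ, inl (Multiplicative.ofAdd ((0 : ZMod s), (n : ZMod s), (0 : ZMod s))) ∈ H := by
    intro n
    have h := H.pow_mem (hw 1) n
    rw [show w 1 = inl b from rfl, ← map_pow] at h
    simpa [b, ← ofAdd_nsmul] using h
  have hc : ∀ n : ℕ, inl (Multiplicative.ofAdd ((0 : ZMod s), (0 : ZMod s), (n : ZMod s))) ∈ H := by
    intro n
    have h := H.pow_mem (hw 2) n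
    rw [show w 2 = inl c from rfl, ← map_pow] at h
    simpa [c, ← ofAdd_nsmul] using h
  have hφ : (base.comp (layerHom G s)).range ≤ ⁅H, H⁆ := by
    rw [MonoidHom.range_eq_map, ← hg₀, Subgroup.map_le_iff_le_comap, Subgroup.closure_le]
    rintro _ ⟨⟨i, hi⟩, rfl⟩
    have hF := H.mul_mem (H.mul_mem (H.inv_mem (hc i)) (hw 3)) (hc i)
    rw [← map_inv, show w 3 = base (digitFunction e m s g) from rfl, conj_base] at hF
    have h := second_difference_mem_commutator hF (ha (e ^ i)) (hb (e ^ (m - i)))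
    have h' := second_difference_digitFunction he hG hg hi
    have hgi : g i = g₀ ⟨i, hi⟩ := dif_pos hi
    rw [← hgi]
    change base (layerHom G s (g i)) ∈ ⁅H, H⁆
    rw [← h']
    exact h
  have hmem : ∀ x, base (layerHom G s x) ∈ H := fun x =>
    Subgroup.commutator_le_self H (hφ ⟨x, rfl⟩)
  refine ⟨H, (base.comp (layerHom G s)).codRestrict H hmem, ⟨fun j => ⟨w j, hw j⟩, ?_⟩, ?_, ?_⟩
  · have h := Subgroup.closure_closure_coe_preimage (k := Set.range w)
    convert h using 2
    ext ⟨x, hx⟩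
    simp [Subtype.ext_iff]
  · intro x y h
    exact layerHom_injective G s (base_injective (congrArg Subtype.val h))
  · rintro _ ⟨x, rfl⟩
    have h : base (layerHom G s x) ∈ (commutator H).map H.subtype := by
      rw [Subgroup.map_subtype_commutator]
      exact hφ ⟨x, rfl⟩
    obtain ⟨y, hy, hyx⟩ := h
    rwa [show y = (base.comp (layerHom G s)).codRestrict H hmem x from Subtype.ext hyx] at hy

theorem pow_eq_one_multiplicative_zmod_cube {s : ℕ}
    (a : Multiplicative (ZMod s × ZMod s × ZMod s)) : a ^ s = 1 := by
  rw [← ofAdd_toAdd a, ← ofAdd_nsmul, ← ofAdd_zero]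
  congr 1
  ext <;> simp

theorem isGeneratedByCard_of_finite (G : Type*) [Group G] [Finite G] :
    IsGeneratedByCard (Nat.card G) G :=
  ⟨(Finite.equivFin G).symm, by rw [(Finite.equivFin G).symm.range_eq_univ, Subgroup.closure_univ]⟩

theorem hasDerivedLength_succ {G H : Type*} [Group G] [Group H] {l : ℕ} (hl : l ≠ 0)
    (hG : HasDerivedLength G l) (φ : G →* H) (hinj : Function.Injective φ)
    (hφ : φ.range ≤ commutator H) (hH : derivedSeries H (l + 1) = ⊥) :
    HasDerivedLength H (l + 1) := by
  refine ⟨hH, fun n hn => ?_⟩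
  -- Triviality of the `(k + 1)`-st term for `H` forces triviality of the `k`-th one for `G`.
  have key : ∀ k, derivedSeries H (k + 1) = ⊥ → l ≤ k := fun k hk => hG.2 <| by
    have h := map_derivedSeries_le_derivedSeries_succ φ hφ k
    rwa [hk, le_bot_iff, Subgroup.map_eq_bot_iff_of_injective _ hinj] at h
  cases n with
  | zero =>
    have h1 : derivedSeries H (0 + 1) = ⊥ :=
      le_bot_iff.1 ((derivedSeries_antitone H (Nat.zero_le 1)).trans (le_of_eq hn))
    exact absurd (Nat.le_zero.1 (key 0 h1)) hl
  | succ k => exact Nat.succ_le_succ (key k hn)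

theorem subsingleton_of_hasDerivedLength_zero {G : Type*} [Group G] (h : HasDerivedLength G 0) :
    Subsingleton G :=
  Subgroup.subsingleton_iff.1 (subsingleton_of_bot_eq_top h.1.symm)

/-- The derived length of the trivial group is raised by embedding it in a cyclic group of order
`p`. -/
theorem exists_hasDerivedLength_one {p : ℕ} (hp : p.Prime) (G : Type u) [Group G]
    [Subsingleton G] :
    ∃ (H : Type u) (_ : Group H),
      GroupEmbedsIn G H ∧ IsGeneratedByCard 4 H ∧ Finite H ∧ IsPGroup p H ∧
      HasDerivedLength H (0 + 1) := by
  have := Fact.mk hp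
  let H := ULift.{u} (Multiplicative (ZMod p))
  have hcard : Nat.card H = p := by simp [H]
  have : Finite H := Nat.finite_of_card_ne_zero (hcard ▸ hp.ne_zero)
  have : Nontrivial H := Finite.one_lt_card_iff_nontrivial.1 (hcard ▸ hp.one_lt)
  have : IsCyclic H := isCyclic_of_prime_card hcard
  obtain ⟨x, hx⟩ := IsCyclic.exists_generator (α := H)
  refine ⟨H, inferInstance, ⟨1, Function.injective_of_subsingleton _⟩, ⟨fun _ => x, ?_⟩,
    inferInstance, IsPGroup.of_card (n := 1) (by rw [hcard, pow_one]), ?_, ?_⟩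
  · rw [Set.range_const, ← Subgroup.zpowers_eq_closure]
    exact (Subgroup.eq_top_iff' _).2 hx
  · change derivedSeries H 1 = ⊥
    rw [derivedSeries_one, commutator_eq_bot_iff_center_eq_top, CommGroup.center_eq_top]
  · intro n hn
    by_contra! h
    obtain rfl : n = 0 := by omega
    exact top_ne_bot (α := Subgroup H) hn

theorem finite_multiplicative_zmod_cube {s : ℕ} (hs : 0 < s) :
    Finite (Multiplicative (ZMod s × ZMod s × ZMod s)) := by
  have : NeZero s := ⟨hs.ne'⟩
  exact inferInstanceAs (Finite (ZMod s × ZMod s × ZMod s))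

/-- A nontrivial finite group of derived length `l` embeds in a four-generated finite group of
derived length `l + 1`, whose exponent divides a power of that of `G`. -/
theorem exists_hasDerivedLength_succ (G : Type u) [Group G] [Finite G] {l : ℕ} (hl : l ≠ 0)
    (hG : HasDerivedLength G l) :
    ∃ (H : Type u) (_ : Group H),
      GroupEmbedsIn G H ∧ IsGeneratedByCard 4 H ∧ Finite H ∧
      (∃ n, ∀ h : H, h ^ Monoid.exponent G ^ n = 1) ∧ HasDerivedLength H (l + 1) := by
  have he : 0 < Monoid.exponent G := Nat.pos_of_ne_zero Monoid.exponent_ne_zero_of_finite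
  obtain ⟨H, φ, hgen, hinj, hφ⟩ := exists_fourGenerated_subgroup he Monoid.pow_exponent_eq_one
    (isGeneratedByCard_of_finite G)
  have := finite_multiplicative_zmod_cube (pow_pos he (Nat.card G + 1))
  refine ⟨H, inferInstance, ⟨φ, hinj⟩, hgen, inferInstance, ⟨Nat.card G + 2, fun h => ?_⟩,
    hasDerivedLength_succ hl hG φ hinj hφ (derivedSeries_subgroup_eq_bot H hG.1)⟩
  exact pow_eq_one_of_subgroup H Monoid.pow_exponent_eq_one pow_eq_one_multiplicative_zmod_cube h

theorem IsPGroup.exists_exponent_eq {p : ℕ} (hp : p.Prime) {G : Type*} [Group G] [Finite G]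
    (hG : IsPGroup p G) : ∃ k, Monoid.exponent G = p ^ k := by
  have := Fact.mk hp
  obtain ⟨n, hn⟩ := IsPGroup.iff_card.1 hG
  obtain ⟨k, -, hk⟩ := (Nat.dvd_prime_pow hp).1 (hn ▸ Group.exponent_dvd_nat_card (G := G))
  exact ⟨k, hk⟩

theorem corollary6 :
    -- Part (1)
    (∀ (M : GroupVariety) (G : Type u) [Group G] (m e : ℕ),
      M.Mem G → IsGeneratedByCard m G → 0 < e → Monoid.exponent G = e →
      ∃ (H : Type u) (_ : Group H),
        GroupEmbedsIn G H ∧ IsGeneratedByCard 4 H ∧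
        M.MemProd (GroupVariety.abelianOfExponent (e ^ (m + 1))) H ∧
        Monoid.exponent H ∣ e ^ (m + 2)) ∧
    -- Part (2), finite groups
    (∀ (M : GroupVariety) (G : Type u) [Group G] [Finite G], M.Mem G →
      ∃ (H : Type u) (_ : Group H),
        GroupEmbedsIn G H ∧ IsGeneratedByCard 4 H ∧ Finite H ∧
        M.MemProd GroupVariety.abelian H) ∧
    -- Part (2), finite solvable groups
    (∀ (G : Type u) [Group G] [Finite G] (l : ℕ), HasDerivedLength G l →
      ∃ (H : Type u) (_ : Group H),
        GroupEmbedsIn G H ∧ IsGeneratedByCard 4 H ∧ Finite H ∧ HasDerivedLength H (l + 1)) ∧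
    -- Part (2), finite (solvable) p-groups
    (∀ (p : ℕ) (_ : p.Prime) (G : Type u) [Group G] [Finite G] (l : ℕ),
      IsPGroup p G → HasDerivedLength G l →
      ∃ (H : Type u) (_ : Group H),
        GroupEmbedsIn G H ∧ IsGeneratedByCard 4 H ∧ Finite H ∧ IsPGroup p H ∧
        HasDerivedLength H (l + 1)) := by
  refine ⟨?_, ?_, ?_, ?_⟩
  · rintro M G _ m e hM hm he rfl
    obtain ⟨H, φ, hgen, hinj, -⟩ :=
      exists_fourGenerated_subgroup he Monoid.pow_exponent_eq_one hm
    exact ⟨H, inferInstance, ⟨φ, hinj⟩, hgen,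
      memProd_subgroup H hM
        (GroupVariety.abelianOfExponent_mem pow_eq_one_multiplicative_zmod_cube),
      Monoid.exponent_dvd_of_forall_pow_eq_one <|
        pow_eq_one_of_subgroup H Monoid.pow_exponent_eq_one pow_eq_one_multiplicative_zmod_cube⟩
  · intro M G _ _ hM
    have he : 0 < Monoid.exponent G := Nat.pos_of_ne_zero Monoid.exponent_ne_zero_of_finite
    obtain ⟨H, φ, hgen, hinj, -⟩ := exists_fourGenerated_subgroup he Monoid.pow_exponent_eq_one
      (isGeneratedByCard_of_finite G)
    have := finite_multiplicative_zmod_cube (pow_pos he (Nat.card G + 1))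
    exact ⟨H, inferInstance, ⟨φ, hinj⟩, hgen, inferInstance,
      memProd_subgroup H hM GroupVariety.abelian_mem⟩
  · intro G _ _ l hl
    rcases eq_or_ne l 0 with rfl | h0
    · have := subsingleton_of_hasDerivedLength_zero hl
      obtain ⟨H, _, h1, h2, h3, -, h4⟩ := exists_hasDerivedLength_one Nat.prime_two G
      exact ⟨H, _, h1, h2, h3, h4⟩
    · obtain ⟨H, _, h1, h2, h3, -, h4⟩ := exists_hasDerivedLength_succ G h0 hl
      exact ⟨H, _, h1, h2, h3, h4⟩
  · intro p hp G _ _ l hG hl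
    rcases eq_or_ne l 0 with rfl | h0
    · have := subsingleton_of_hasDerivedLength_zero hl
      exact exists_hasDerivedLength_one hp G
    · obtain ⟨H, _, h1, h2, h3, ⟨n, hn⟩, h4⟩ := exists_hasDerivedLength_succ G h0 hl
      obtain ⟨k, hk⟩ := hG.exists_exponent_eq hp
      refine ⟨H, _, h1, h2, h3, fun h => ⟨k * n, ?_⟩, h4⟩
      rw [pow_mul, ← hk, hn]
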